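/- All spaces are over $\mathbb C$. Let $V$ be a vertex operator algebra or, more generally, a vertex operator superalgebra: $V=\bigoplus_{n\in\frac12\mathbb Z}V_n$ with $L(0)=n$ on $V_n$, $\dim V_n<\infty$, $V_n=0$ for $n$ sufficiently small, parity equal to $2n$ mod $2$, vacuum, creation, Virasoro and $L(-1)$-derivative axioms, and the Jacobi identity with the usual sign $(-1)^{|a||b|}$; vertex operator algebras are the case where all weights are integers. Conventions: * A weak $V$-module is a vector space $M$ with a map $Y_M(a,z)=\sum_{n\in\mathbb Z}a_nz^{-n-1}$ $(a\in V)$ satisfying the truncation, vacuum, Jacobi, Virasoro (same central charge) and $L(-1)$-derivative axioms; no parity grading of $M$ is required. It is a $V$-module if moreover $M=\coprod_{\lambda\in\mathbb C}M_\lambda$ with $M_\lambda$ the $\lambda$-eigenspace of $L(0)$, $\dim M_\lambda<\infty$, and, for each $\lambda$, $M_{\lambda+n}=0$ for $n\in\mathbb Z$ sufficiently small. * $V$ is simple if it is irreducible as a module over itself, and rational if every $V$-module is completely reducible (a direct sum of irreducible modules). * An intertwining operator of type $\binom{M_3}{M_1\,M_2}$ is a linear map $w\mapsto\mathcal Y(w,z)=\sum_{n\in\mathbb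 C}w_nz^{-n-1}$ from $M_1$ to $\mathrm{Hom}(M_2,M_3)\{z\}$ such that, for fixed $w\in M_1$, $x\in M_2$, $c\in\mathbb C$, $w_{c+n}x=0$ for sufficiently large $n\in\mathbb Q$, and satisfying the $L(-1)$-derivative property and the Jacobi identity (with sign $(-1)^{|a||w|}$ for a parity decomposition of $M_1$ compatible with that of $V$, if $V$ is a superalgebra). A tensor product $M_1\boxtimes M_2$ is a weak module with an intertwining operator $F$ of type $\binom{M_1\boxtimes M_2}{M_1\,M_2}$ through which every intertwining operator of type $\binom{W}{M_1\,M_2}$, $W$ any weak module, factors as $\psi\circ F$ for a unique homomorphism $\psi$. * An irreducible weak $V$-module $M$ is a simple current if $M\boxtimes\cdot$ is a bijection of the set of equivalence classes of irreducible weak $V$-modules onto itself. **Theorem.** Let $G$ be a finite abelian group and $V=\bigoplus_{g\in G}V^g$ a vertex operator (super)algebra such that 1. $a_nV^h\subseteq V^{g+h}$ for $a\in V^g$, $n\in\mathbb Z$, $g,h\in G$; 2. $V^0$ is a vertex operator sub(super)algebra (with the same vacuum and conformal vector), is simple and rational, and each $V^g$ is a simple current $V^0$-module; 3. for every subgroup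 $H\le G$, $V^{(H)}=\bigoplus_{h\in H}V^h$ is simple, and for every $g\in G$, $V^{(g+H)}=\bigoplus_{h\in H}V^{g+h}$ is a simple current $V^{(H)}$-module (the parity decompositions in 2 and 3 being those inherited from $V$); 4. whenever $W$ is a $V$-module and $W^0\subseteq W$ is an irreducible $V^0$-submodule, there is a $V$-module $M=\bigoplus_{g\in G}M^g$ with $a_nM^h\subseteq M^{g+h}$ for all $a\in V^g$, $n\in\mathbb Z$, $g,h\in G$, and $M^0\cong W^0$ as $V^0$-modules. Then $V$ is rational. -/

import Mathlib

universe u v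

noncomputable section

/-- The Koszul sign `(-1)^{ij}` of two parities. -/
def koszulSign (i j : ZMod 2) : ℤ := if i = 1 ∧ j = 1 then -1 else 1

/-- The data of a vertex operator (super)algebra on a complex vector space `V`: the modes
`mode n a b = a_n b` of the state-field map `Y(a,z) = ∑ a_n z^{-n-1}`, the vacuum vector and the
conformal vector. -/
structure VertexData (V : Type u) [AddCommGroup V] [Module ℂ V] where
  mode : ℤ → V →ₗ[ℂ] V →ₗ[ℂ] V
  vac : V
  conf : V

namespace VertexData

variable {V : Type u} [AddCommGroup V] [Module ℂ V] (D : VertexData V)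

/-- The operator `L(n) = ω_{n+1}`. -/
def L (n : ℤ) : V →ₗ[ℂ] V := D.mode (n + 1) D.conf

/-- The homogeneous subspace of weight `p/2`, i.e. the eigenspace of `L(0)` for `p/2`. -/
def wt (p : ℤ) : Submodule ℂ V := Module.End.eigenspace (D.L 0) ((p : ℂ) / 2)

/-- The even part (`i = 0`: integral weights) and the odd part (`i = 1`: weights in `1/2 + ℤ`). -/
def part (i : ZMod 2) : Submodule ℂ V := ⨆ p : {p : ℤ // (p : ZMod 2) = i}, D.wt p

end VertexData

/-- A vertex operator superalgebra `(V, Y, 1, ω)` of rank `rank`: it is `(1/2)ℤ`-graded by the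
eigenvalues of `L(0)`, and the parity of a homogeneous vector is twice its weight, mod `2`.
A vertex operator algebra is the case in which all weights are integers (`part 1 = ⊥`), when all
signs are `+1`.  The Jacobi identity is written in components, as the equality of the coefficients
of `z₀^{-r-1} z₁^{-p-1} z₂^{-q-1}`; all its sums have only finitely many nonzero terms
because of `truncation`. -/
structure VOSA (V : Type u) [AddCommGroup V] [Module ℂ V] extends VertexData V where
  rank : ℂ
  truncation : ∀ a b : V, ∃ N : ℤ, ∀ n, N ≤ n → mode n a b = 0
  vac_mode : ∀ (n : ℤ) (b : V), mode n vac b = if n = -1 then b else 0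
  creation : ∀ a : V, mode (-1) a vac = a ∧ ∀ n : ℤ, 0 ≤ n → mode n a vac = 0
  jacobi : ∀ (i j : ZMod 2), ∀ a ∈ toVertexData.part i, ∀ b ∈ toVertexData.part j,
    ∀ (c : V) (p q r : ℤ),
      ∑ᶠ k : ℕ, Ring.choose p k • mode (p + q - k) (mode (r + k) a b) c =
      ∑ᶠ k : ℕ, ((-1) ^ k * Ring.choose r k) •
        (mode (p + r - k) a (mode (q + k) b c) -
          (koszulSign i j * (r.negOnePow : ℤ)) • mode (q + r - k) b (mode (p + k) a c))
  virasoro : ∀ (m n : ℤ) (b : V),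
    toVertexData.L m (toVertexData.L n b) - toVertexData.L n (toVertexData.L m b) =
      ((m : ℂ) - n) • toVertexData.L (m + n) b +
        (if m + n = 0 then (((m : ℂ) ^ 3 - m) / 12 * rank) • b else 0)
  derivative : ∀ (n : ℤ) (a b : V),
    mode n (toVertexData.L (-1) a) b = (-(n : ℂ)) • mode (n - 1) a b
  iSup_wt : ⨆ p : ℤ, toVertexData.wt p = ⊤
  finite_wt : ∀ p : ℤ, FiniteDimensional ℂ (toVertexData.wt p)
  bounded_wt : ∃ N : ℤ, ∀ p, p < N → toVertexData.wt p = ⊥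

/-- A weak (untwisted) module for `𝒱`: `mode n a w = a_n w`, `Y_M(a,z) = ∑ a_n z^{-n-1}`. -/
structure WeakModule {V : Type u} [AddCommGroup V] [Module ℂ V] (𝒱 : VOSA V)
    (M : Type u) [AddCommGroup M] [Module ℂ M] where
  mode : ℤ → V →ₗ[ℂ] M →ₗ[ℂ] M
  truncation : ∀ (a : V) (w : M), ∃ N : ℤ, ∀ n, N ≤ n → mode n a w = 0
  vac_mode : ∀ (n : ℤ) (w : M), mode n 𝒱.vac w = if n = -1 then w else 0
  jacobi : ∀ (i j : ZMod 2), ∀ a ∈ 𝒱.part i, ∀ b ∈ 𝒱.part j, ∀ (w : M) (p q r : ℤ),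
      ∑ᶠ k : ℕ, Ring.choose p k • mode (p + q - k) (𝒱.mode (r + k) a b) w =
      ∑ᶠ k : ℕ, ((-1) ^ k * Ring.choose r k) •
        (mode (p + r - k) a (mode (q + k) b w) -
          (koszulSign i j * (r.negOnePow : ℤ)) • mode (q + r - k) b (mode (p + k) a w))
  virasoro : ∀ (m n : ℤ) (w : M),
    mode (m + 1) 𝒱.conf (mode (n + 1) 𝒱.conf w) - mode (n + 1) 𝒱.conf (mode (m + 1) 𝒱.conf w) =
      ((m : ℂ) - n) • mode (m + n + 1) 𝒱.conf w +
        (if m + n = 0 then (((m : ℂ) ^ 3 - m) / 12 * 𝒱.rank) • w else 0)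
  derivative : ∀ (n : ℤ) (a : V) (w : M),
    mode n (𝒱.L (-1) a) w = (-(n : ℂ)) • mode (n - 1) a w

namespace VOSA

variable {V : Type u} [AddCommGroup V] [Module ℂ V] (𝒱 : VOSA V)

/-- `V` as a module over itself. -/
def adjoint : WeakModule 𝒱 V where
  mode := 𝒱.mode
  truncation := 𝒱.truncation
  vac_mode := 𝒱.vac_mode
  jacobi := 𝒱.jacobi
  virasoro := 𝒱.virasoro
  derivative := 𝒱.derivative

/-- A vertex operator sub(super)algebra: a subspace containing the vacuum and the (same) conformal
vector and closed under all products `a_n b`. -/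
structure IsSubalgebra (U : Submodule ℂ V) : Prop where
  vac_mem : 𝒱.vac ∈ U
  conf_mem : 𝒱.conf ∈ U
  mode_mem : ∀ (n : ℤ), ∀ a ∈ U, ∀ b ∈ U, 𝒱.mode n a b ∈ U

variable {𝒱} {U : Submodule ℂ V}

/-- The restriction of the data of `𝒱` to a subalgebra. -/
def restrictData (hU : 𝒱.IsSubalgebra U) : VertexData U where
  mode n := LinearMap.mk₂ ℂ (fun a b => ⟨𝒱.mode n a b, hU.mode_mem n a a.2 b b.2⟩)
    (fun a a' b => by ext; simp) (fun c a b => by ext; simp)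
    (fun a b b' => by ext; simp) (fun c a b => by ext; simp)
  vac := ⟨𝒱.vac, hU.vac_mem⟩
  conf := ⟨𝒱.conf, hU.conf_mem⟩

@[simp] lemma restrictData_mode (hU : 𝒱.IsSubalgebra U) (n : ℤ) (a b : U) :
    (((restrictData hU).mode n a b : U) : V) = 𝒱.mode n a b := rfl

@[simp] lemma restrictData_L (hU : 𝒱.IsSubalgebra U) (n : ℤ) (b : U) :
    (((restrictData hU).L n b : U) : V) = 𝒱.L n b := rfl

lemma mem_restrictData_wt (hU : 𝒱.IsSubalgebra U) (p : ℤ) (b : U) :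
    b ∈ (restrictData hU).wt p ↔ (b : V) ∈ 𝒱.wt p := by
  simp only [VertexData.wt, Module.End.mem_eigenspace_iff, Subtype.ext_iff, restrictData_L,
    Submodule.coe_smul]

lemma coe_mem_part (hU : 𝒱.IsSubalgebra U) (i : ZMod 2) (b : U)
    (hb : b ∈ (restrictData hU).part i) : (b : V) ∈ 𝒱.part i := by
  have : (restrictData hU).part i ≤ (𝒱.part i).comap U.subtype := by
    refine iSup_le fun p b hb => ?_
    exact Submodule.mem_iSup_of_mem p ((mem_restrictData_wt hU p b).1 hb)
  exact this hb

/-- A subspace stable under `L(0)` is spanned by homogeneous vectors. -/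
lemma exists_homogeneous_sum (h : ∀ x ∈ U, 𝒱.L 0 x ∈ U) (x : V) (hx : x ∈ U) :
    ∃ f : ℤ →₀ V, (∀ p, f p ∈ 𝒱.wt p) ∧ (∀ p, f p ∈ U) ∧ (f.sum fun _ y => y) = x := by
  have hx' : x ∈ ⨆ p : ℤ, 𝒱.wt p := by rw [𝒱.iSup_wt]; trivial
  obtain ⟨f, hf, hsum⟩ := (Submodule.mem_iSup_iff_exists_finsupp _ _).1 hx'
  refine ⟨f, hf, ?_, hsum⟩
  let T : Module.End ℂ (V ⧸ U) := U.mapQ U (𝒱.L 0) h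
  have hind : iSupIndep fun p : ℤ => Module.End.eigenspace T ((p : ℂ) / 2) := by
    refine (Module.End.eigenspaces_iSupIndep T).comp (f := fun p : ℤ => (p : ℂ) / 2) ?_
    intro p q hpq
    have : (p : ℂ) = q := by simpa using hpq
    exact_mod_cast this
  have hz := (iSupIndep_iff_finsetSum_eq_zero_imp_eq_zero _).1 hind f.support
    (fun p => U.mkQ (f p)) ?_ ?_
  · intro p
    by_cases hp : p ∈ f.support
    · simpa using hz p hp
    · rw [Finsupp.notMem_support_iff.1 hp]; exact U.zero_mem
  · intro p _
    rw [Module.End.mem_eigenspace_iff]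
    have := Module.End.mem_eigenspace_iff.1 (hf p)
    simp only [T, Submodule.mkQ_apply, Submodule.mapQ_apply, this, Submodule.Quotient.mk_smul]
  · rw [← map_sum]
    have : ∑ p ∈ f.support, f p = x := hsum
    rw [this]
    simpa using hx

/-- A subalgebra as a vertex operator (super)algebra in its own right. -/
def restrict (𝒱 : VOSA V) (U : Submodule ℂ V) (hU : 𝒱.IsSubalgebra U) : VOSA U where
  toVertexData := restrictData hU
  rank := 𝒱.rank
  truncation a b := by
    obtain ⟨N, hN⟩ := 𝒱.truncation a b
    exact ⟨N, fun n hn => Subtype.ext (hN n hn)⟩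
  vac_mode n b := by
    refine Subtype.ext ((𝒱.vac_mode n b).trans ?_)
    split_ifs <;> rfl
  creation a := ⟨Subtype.ext (𝒱.creation a).1, fun n hn => Subtype.ext ((𝒱.creation a).2 n hn)⟩
  jacobi i j a ha b hb c p q r := by
    have h := 𝒱.jacobi i j a (coe_mem_part hU i a ha) b (coe_mem_part hU j b hb) c p q r
    apply Subtype.coe_injective
    have key : ∀ f : ℕ → U, ((∑ᶠ k, f k : U) : V) = ∑ᶠ k, (f k : V) := fun f =>
      U.subtype.toAddMonoidHom.map_finsum_of_injective Subtype.coe_injective f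
    change ((∑ᶠ k, _ : U) : V) = ((∑ᶠ k, _ : U) : V)
    rw [key, key]
    exact h
  virasoro m n b := by
    refine Subtype.ext ((𝒱.virasoro m n b).trans ?_)
    split_ifs <;> rfl
  derivative n a b := Subtype.ext (𝒱.derivative n a b)
  iSup_wt := by
    refine eq_top_iff.2 fun x _ => ?_
    obtain ⟨f, hf, hfU, hsum⟩ := exists_homogeneous_sum
      (fun y hy => hU.mode_mem _ _ hU.conf_mem y hy) (x : V) x.2
    have hx : x = ∑ p ∈ f.support, (⟨f p, hfU p⟩ : U) := by
      apply Subtype.ext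
      rw [← hsum, Finsupp.sum, AddSubmonoidClass.coe_finsetSum]
    rw [hx]
    exact Submodule.sum_mem _ fun p _ =>
      Submodule.mem_iSup_of_mem p ((mem_restrictData_wt hU p _).2 (hf p))
  finite_wt p := by
    have := 𝒱.finite_wt p
    let g : (restrictData hU).wt p →ₗ[ℂ] 𝒱.wt p :=
      (U.subtype.comp ((restrictData hU).wt p).subtype).codRestrict _
        fun b => (mem_restrictData_wt hU p b.1).1 b.2
    refine FiniteDimensional.of_injective g fun b b' h => ?_
    exact Subtype.ext (Subtype.ext (congrArg (fun y : 𝒱.wt p => (y : V)) h))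
  bounded_wt := by
    obtain ⟨N, hN⟩ := 𝒱.bounded_wt
    refine ⟨N, fun p hp => (Submodule.eq_bot_iff _).2 fun b hb => ?_⟩
    have := (mem_restrictData_wt hU p b).1 hb
    rw [hN p hp] at this
    exact Subtype.ext this

end VOSA

namespace WeakModule

variable {V : Type u} [AddCommGroup V] [Module ℂ V] {𝒱 : VOSA V}
variable {M : Type u} [AddCommGroup M] [Module ℂ M]

/-- The operator `L(n) = ω_{n+1}` on a weak module. -/
def L (𝓜 : WeakModule 𝒱 M) (n : ℤ) : M →ₗ[ℂ] M := 𝓜.mode (n + 1) 𝒱.conf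

/-- A module (as opposed to a weak module): `M = ∐_{l ∈ ℂ} M_l` with `M_l` the eigenspace of `L(0)`
for `l`, every `M_l` is finite dimensional, and `M_{l+n} = 0` for `n ∈ ℤ` sufficiently small. -/
structure IsOrdinary (𝓜 : WeakModule 𝒱 M) : Prop where
  iSup_eigenspace : ⨆ l : ℂ, Module.End.eigenspace (𝓜.L 0) l = ⊤
  finite : ∀ l : ℂ, FiniteDimensional ℂ (Module.End.eigenspace (𝓜.L 0) l)
  bounded : ∀ l : ℂ, ∃ N : ℤ, ∀ n : ℤ, n < N → Module.End.eigenspace (𝓜.L 0) (l + n) = ⊥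

/-- `N` is stable under all operators `a_n`, i.e. it is a submodule of the weak module. -/
def IsInvariant (𝓜 : WeakModule 𝒱 M) (N : Submodule ℂ M) : Prop :=
  ∀ (n : ℤ) (a : V), ∀ w ∈ N, 𝓜.mode n a w ∈ N

/-- A weak module is irreducible if it is nonzero and has no proper nonzero submodule. -/
def IsIrreducible (𝓜 : WeakModule 𝒱 M) : Prop :=
  Nontrivial M ∧ ∀ N : Submodule ℂ M, 𝓜.IsInvariant N → N = ⊥ ∨ N = ⊤

/-- A submodule of a weak module, as a weak module. -/
def ofInvariant (𝓜 : WeakModule 𝒱 M) (N : Submodule ℂ M) (hN : 𝓜.IsInvariant N) :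
    WeakModule 𝒱 N where
  mode n := LinearMap.mk₂ ℂ (fun a w => ⟨𝓜.mode n a w, hN n a w w.2⟩)
    (fun a a' b => by ext; simp) (fun c a b => by ext; simp)
    (fun a b b' => by ext; simp) (fun c a b => by ext; simp)
  truncation a w := by
    obtain ⟨K, hK⟩ := 𝓜.truncation a w
    exact ⟨K, fun n hn => Subtype.ext (hK n hn)⟩
  vac_mode n w := by
    refine Subtype.ext ((𝓜.vac_mode n w).trans ?_)
    split_ifs <;> rfl
  jacobi i j a ha b hb w p q r := by
    have h := 𝓜.jacobi i j a ha b hb w p q r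
    apply Subtype.coe_injective
    have key : ∀ f : ℕ → N, ((∑ᶠ k, f k : N) : M) = ∑ᶠ k, (f k : M) := fun f =>
      N.subtype.toAddMonoidHom.map_finsum_of_injective Subtype.coe_injective f
    change ((∑ᶠ k, _ : N) : M) = ((∑ᶠ k, _ : N) : M)
    rw [key, key]
    exact h
  virasoro m n w := by
    refine Subtype.ext ((𝓜.virasoro m n w).trans ?_)
    split_ifs <;> rfl
  derivative n a w := Subtype.ext (𝓜.derivative n a w)

/-- A weak module for `𝒱`, viewed as a weak module for a subalgebra. -/
def restrictAlg (𝓜 : WeakModule 𝒱 M) {U : Submodule ℂ V} (hU : 𝒱.IsSubalgebra U) :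
    WeakModule (𝒱.restrict U hU) M where
  mode n := (𝓜.mode n).comp U.subtype
  truncation a w := 𝓜.truncation a w
  vac_mode n w := 𝓜.vac_mode n w
  jacobi i j a ha b hb w p q r :=
    𝓜.jacobi i j a (VOSA.coe_mem_part hU i a ha) b (VOSA.coe_mem_part hU j b hb) w p q r
  virasoro m n w := 𝓜.virasoro m n w
  derivative n a w := 𝓜.derivative n a w

/-- A weak module is completely reducible if it is a direct sum of irreducible submodules. -/
def IsCompletelyReducible (𝓜 : WeakModule 𝒱 M) : Prop :=
  ∃ S : Set (Submodule ℂ M),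
    (∀ N ∈ S, ∃ hN : 𝓜.IsInvariant N, (𝓜.ofInvariant N hN).IsIrreducible) ∧
    sSupIndep S ∧ sSup S = ⊤

variable {M₁ : Type u} [AddCommGroup M₁] [Module ℂ M₁]
variable {M₂ : Type u} [AddCommGroup M₂] [Module ℂ M₂]
variable {M₃ : Type u} [AddCommGroup M₃] [Module ℂ M₃]

/-- Homomorphisms of weak modules. -/
def IsHom (𝓜₁ : WeakModule 𝒱 M₁) (𝓜₂ : WeakModule 𝒱 M₂) (f : M₁ →ₗ[ℂ] M₂) : Prop :=
  ∀ (n : ℤ) (a : V) (w : M₁), f (𝓜₁.mode n a w) = 𝓜₂.mode n a (f w)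

/-- Isomorphism of weak modules. -/
def Isomorphic (𝓜₁ : WeakModule 𝒱 M₁) (𝓜₂ : WeakModule 𝒱 M₂) : Prop :=
  ∃ e : M₁ ≃ₗ[ℂ] M₂, 𝓜₁.IsHom 𝓜₂ e.toLinearMap

lemma Isomorphic.refl (𝓜₁ : WeakModule 𝒱 M₁) : 𝓜₁.Isomorphic 𝓜₁ :=
  ⟨LinearEquiv.refl ℂ M₁, fun _ _ _ => rfl⟩

lemma Isomorphic.symm {𝓜₁ : WeakModule 𝒱 M₁} {𝓜₂ : WeakModule 𝒱 M₂}
    (h : 𝓜₁.Isomorphic 𝓜₂) : 𝓜₂.Isomorphic 𝓜₁ := by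
  obtain ⟨e, he⟩ := h
  refine ⟨e.symm, fun n a w => ?_⟩
  have := he n a (e.symm w)
  simp only [LinearEquiv.coe_coe, LinearEquiv.apply_symm_apply] at this ⊢
  rw [← this, LinearEquiv.symm_apply_apply]

lemma Isomorphic.trans {𝓜₁ : WeakModule 𝒱 M₁} {𝓜₂ : WeakModule 𝒱 M₂} {𝓜₃ : WeakModule 𝒱 M₃}
    (h : 𝓜₁.Isomorphic 𝓜₂) (h' : 𝓜₂.Isomorphic 𝓜₃) : 𝓜₁.Isomorphic 𝓜₃ := by
  obtain ⟨e, he⟩ := h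
  obtain ⟨e', he'⟩ := h'
  refine ⟨e.trans e', fun n a w => ?_⟩
  have h1 := he n a w
  have h2 := he' n a (e w)
  simp only [LinearEquiv.coe_coe, LinearEquiv.trans_apply] at h1 h2 ⊢
  rw [h1, h2]

/-- A parity decomposition `M = M⁰ ⊕ M¹` of a weak module, compatible with that of `V`.
For a vertex operator algebra (`part 1 = ⊥`) one can take `M⁰ = M`, `M¹ = 0`. -/
structure IsParity (𝓜 : WeakModule 𝒱 M) (par : ZMod 2 → Submodule ℂ M) : Prop where
  isCompl : IsCompl (par 0) (par 1)
  mode_mem : ∀ (n : ℤ) (i j : ZMod 2), ∀ a ∈ 𝒱.part i, ∀ w ∈ par j, 𝓜.mode n a w ∈ par (i + j)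

/-- Intertwining operators `𝒴(w,z) = ∑_{n ∈ ℂ} w_n z^{-n-1}` of type `(M₃; M₁ M₂)`, with
`mode n w x = w_n x`.  The sign in the Jacobi identity refers to the parity decomposition `par` of
`M₁`; for a vertex operator algebra it is always `+1`, whatever `par` is. -/
structure Intertwining (𝓜₁ : WeakModule 𝒱 M₁) (par : ZMod 2 → Submodule ℂ M₁)
    (𝓜₂ : WeakModule 𝒱 M₂) (𝓜₃ : WeakModule 𝒱 M₃) where
  mode : ℂ → M₁ →ₗ[ℂ] M₂ →ₗ[ℂ] M₃
  truncation : ∀ (w : M₁) (x : M₂) (c : ℂ), ∃ N : ℚ, ∀ n : ℚ, N ≤ n → mode (c + n) w x = 0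
  jacobi : ∀ (i j : ZMod 2), ∀ a ∈ 𝒱.part i, ∀ w ∈ par j, ∀ (x : M₂) (p r : ℤ) (q : ℂ),
      ∑ᶠ k : ℕ, Ring.choose p k • mode (p + q - k) (𝓜₁.mode (r + k) a w) x =
      ∑ᶠ k : ℕ, ((-1) ^ k * Ring.choose r k) •
        (𝓜₃.mode (p + r - k) a (mode (q + k) w x) -
          (koszulSign i j * (r.negOnePow : ℤ)) • mode (q + r - k) w (𝓜₂.mode (p + k) a x))
  derivative : ∀ (n : ℂ) (w : M₁) (x : M₂), mode n (𝓜₁.L (-1) w) x = (-n) • mode (n - 1) w x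

/-- `(𝓜₃, F)` is a tensor product of the ordered pair `(𝓜₁, 𝓜₂)`: every intertwining operator of
type `(W; M₁ M₂)` is `ψ ∘ F` for a unique homomorphism `ψ` from `M₃` to `W`. -/
def IsTensorProduct (𝓜₁ : WeakModule 𝒱 M₁) (par : ZMod 2 → Submodule ℂ M₁)
    (𝓜₂ : WeakModule 𝒱 M₂) (𝓜₃ : WeakModule 𝒱 M₃) (F : Intertwining 𝓜₁ par 𝓜₂ 𝓜₃) : Prop :=
  ∀ (W : Type u) [AddCommGroup W] [Module ℂ W] (𝓦 : WeakModule 𝒱 W)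
    (I : Intertwining 𝓜₁ par 𝓜₂ 𝓦),
    ∃! ψ : M₃ →ₗ[ℂ] W, 𝓜₃.IsHom 𝓦 ψ ∧
      ∀ (n : ℂ) (w : M₁) (x : M₂), I.mode n w x = ψ (F.mode n w x)

end WeakModule

/-- An irreducible weak module, bundled with its underlying space. -/
structure IrrWeakModule {V : Type u} [AddCommGroup V] [Module ℂ V] (𝒱 : VOSA V) where
  carrier : Type u
  [addCommGroup : AddCommGroup carrier]
  [module : Module ℂ carrier]
  weak : WeakModule 𝒱 carrier
  irreducible : weak.IsIrreducible

attribute [instance] IrrWeakModule.addCommGroup IrrWeakModule.module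

/-- Isomorphism of irreducible weak modules. -/
instance irrSetoid {V : Type u} [AddCommGroup V] [Module ℂ V] (𝒱 : VOSA V) :
    Setoid (IrrWeakModule 𝒱) where
  r A B := A.weak.Isomorphic B.weak
  iseqv := ⟨fun A => WeakModule.Isomorphic.refl A.weak, fun h => h.symm, fun h h' => h.trans h'⟩

/-- The set `Irr(V)` of equivalence classes of irreducible weak modules. -/
def Irr {V : Type u} [AddCommGroup V] [Module ℂ V] (𝒱 : VOSA V) : Type (u + 1) :=
  Quotient (irrSetoid 𝒱)

/-- The class of an irreducible weak module in `Irr(V)`. -/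
def Irr.mk {V : Type u} [AddCommGroup V] [Module ℂ V] {𝒱 : VOSA V} (A : IrrWeakModule 𝒱) :
    Irr 𝒱 := Quotient.mk (irrSetoid 𝒱) A

/-- `𝓜` (with the parity decomposition `par`) is a simple current: it is an irreducible weak module
and `A ↦ 𝓜 ⊠ A` is a bijection from `Irr(V)` to `Irr(V)`. -/
def WeakModule.IsSimpleCurrent {V : Type u} [AddCommGroup V] [Module ℂ V] {𝒱 : VOSA V}
    {M : Type u} [AddCommGroup M] [Module ℂ M] (𝓜 : WeakModule 𝒱 M)
    (par : ZMod 2 → Submodule ℂ M) : Prop :=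
  𝓜.IsIrreducible ∧ 𝓜.IsParity par ∧
    ∃ T : Irr 𝒱 → Irr 𝒱, Function.Bijective T ∧
      ∀ A : IrrWeakModule 𝒱, ∃ B : IrrWeakModule 𝒱, Irr.mk B = T (Irr.mk A) ∧
        ∃ F : WeakModule.Intertwining 𝓜 par A.weak B.weak,
          WeakModule.IsTensorProduct 𝓜 par A.weak B.weak F

namespace VOSA

variable {V : Type u} [AddCommGroup V] [Module ℂ V]

/-- `V` is simple if it is irreducible as a module over itself. -/
def IsSimple (𝒱 : VOSA V) : Prop := 𝒱.adjoint.IsIrreducible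

/-- `V` is rational if every `V`-module is completely reducible. -/
def IsRational (𝒱 : VOSA V) : Prop :=
  ∀ (M : Type u) [AddCommGroup M] [Module ℂ M] (𝓜 : WeakModule 𝒱 M),
    𝓜.IsOrdinary → 𝓜.IsCompletelyReducible

/-- A grading `V = ⊕_{g ∈ G} V^g` with `a_n V^h ⊆ V^{g+h}` for `a ∈ V^g`, such that `V^0` is a
vertex operator sub(super)algebra. -/
structure Grading (𝒱 : VOSA V) (G : Type v) [AddCommGroup G] where
  comp : G → Submodule ℂ V
  independent : iSupIndep comp
  iSup_comp : ⨆ g, comp g = ⊤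
  mode_mem : ∀ (n : ℤ) (g h : G), ∀ a ∈ comp g, ∀ b ∈ comp h, 𝒱.mode n a b ∈ comp (g + h)
  vac_mem : 𝒱.vac ∈ comp 0
  conf_mem : 𝒱.conf ∈ comp 0

namespace Grading

variable {𝒱 : VOSA V} {G : Type v} [AddCommGroup G] (Γ : 𝒱.Grading G)

lemma isSubalgebra_zero : 𝒱.IsSubalgebra (Γ.comp 0) where
  vac_mem := Γ.vac_mem
  conf_mem := Γ.conf_mem
  mode_mem n a ha b hb := by simpa using Γ.mode_mem n 0 0 a ha b hb

/-- The vertex operator (super)algebra `V^0`. -/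
def zero : VOSA (Γ.comp 0) := 𝒱.restrict (Γ.comp 0) Γ.isSubalgebra_zero

lemma isInvariant_comp (g : G) :
    (𝒱.adjoint.restrictAlg Γ.isSubalgebra_zero).IsInvariant (Γ.comp g) := by
  intro n a b hb
  have := Γ.mode_mem n 0 g a a.2 b hb
  rwa [zero_add] at this

/-- `V^g` as a `V^0`-module. -/
def compModule (g : G) : WeakModule Γ.zero (Γ.comp g) :=
  (𝒱.adjoint.restrictAlg Γ.isSubalgebra_zero).ofInvariant (Γ.comp g) (Γ.isInvariant_comp g)

/-- The subspace `V^{(g+H)} = ⊕_{h ∈ H} V^{h+g}`. -/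
def coset (H : AddSubgroup G) (g : G) : Submodule ℂ V := ⨆ h : H, Γ.comp (h + g)

lemma mode_mem_coset (H : AddSubgroup G) (g : G) (n : ℤ) (a : V) (ha : a ∈ Γ.coset H 0) (b : V)
    (hb : b ∈ Γ.coset H g) : 𝒱.mode n a b ∈ Γ.coset H g := by
  have h1 : ∀ h : H, ∀ a ∈ Γ.comp (h + 0), Γ.coset H g ≤ (Γ.coset H g).comap (𝒱.mode n a) := by
    refine fun h a ha => iSup_le fun h' b hb => Submodule.mem_iSup_of_mem (h + h') ?_
    have := Γ.mode_mem n _ _ a ha b hb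
    simpa [add_assoc] using this
  have h2 : Γ.coset H 0 ≤ (Γ.coset H g).comap ((𝒱.mode n).flip b) :=
    iSup_le fun h a ha => h1 h a ha hb
  exact h2 ha

lemma comp_zero_le_coset (H : AddSubgroup G) : Γ.comp 0 ≤ Γ.coset H 0 := by
  refine le_trans (le_of_eq ?_) (le_iSup (fun h : H => Γ.comp (h + 0)) 0)
  simp

lemma isSubalgebra_coset (H : AddSubgroup G) : 𝒱.IsSubalgebra (Γ.coset H 0) where
  vac_mem := Γ.comp_zero_le_coset H Γ.vac_mem
  conf_mem := Γ.comp_zero_le_coset H Γ.conf_mem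
  mode_mem n a ha b hb := Γ.mode_mem_coset H 0 n a ha b hb

/-- The vertex operator (super)algebra `V^{(H)}`. -/
def sub (H : AddSubgroup G) : VOSA (Γ.coset H 0) := 𝒱.restrict _ (Γ.isSubalgebra_coset H)

/-- `V^{(g+H)}` as a `V^{(H)}`-module. -/
def cosetModule (H : AddSubgroup G) (g : G) : WeakModule (Γ.sub H) (Γ.coset H g) :=
  (𝒱.adjoint.restrictAlg (Γ.isSubalgebra_coset H)).ofInvariant (Γ.coset H g)
    fun n a b hb => Γ.mode_mem_coset H g n a a.2 b hb

end Grading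

/-- The parity decomposition that a subspace of `V` inherits from `V`. -/
def parityOn (𝒱 : VOSA V) (N : Submodule ℂ V) (i : ZMod 2) : Submodule ℂ N :=
  (𝒱.part i).comap N.subtype

end VOSA

/-- A `G`-graded structure on a weak `V`-module `M`: `M = ⊕_{g ∈ G} M^g` and
`a_n M^h ⊆ M^{g+h}` for `a ∈ V^g`. -/
structure WeakModule.GradedBy {V : Type u} [AddCommGroup V] [Module ℂ V] {𝒱 : VOSA V}
    {M : Type u} [AddCommGroup M] [Module ℂ M] (𝓜 : WeakModule 𝒱 M)
    {G : Type v} [AddCommGroup G] (Γ : 𝒱.Grading G) where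
  comp : G → Submodule ℂ M
  independent : iSupIndep comp
  iSup_comp : ⨆ g, comp g = ⊤
  mode_mem : ∀ (n : ℤ) (g h : G), ∀ a ∈ Γ.comp g, ∀ w ∈ comp h, 𝓜.mode n a w ∈ comp (g + h)

namespace WeakModule.GradedBy

variable {V : Type u} [AddCommGroup V] [Module ℂ V] {𝒱 : VOSA V}
  {M : Type u} [AddCommGroup M] [Module ℂ M] {𝓜 : WeakModule 𝒱 M}
  {G : Type v} [AddCommGroup G] {Γ : 𝒱.Grading G}

/-- `M^0` as a `V^0`-module. -/
def zeroModule (D : 𝓜.GradedBy Γ) : WeakModule Γ.zero (D.comp 0) :=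
  (𝓜.restrictAlg Γ.isSubalgebra_zero).ofInvariant (D.comp 0) fun n a w hw => by
    have := D.mode_mem n 0 0 a a.2 w hw
    rwa [zero_add] at this

end WeakModule.GradedBy

/-- Every irreducible `V^0`-submodule `W⁰` of a `V`-module `W` lifts: there is a `V`-module
`M = ⊕_{g ∈ G} M^g`, graded compatibly with `V`, with `M^0 = W⁰` as `V^0`-modules. -/
def VOSA.Grading.LiftingProperty {V : Type u} [AddCommGroup V] [Module ℂ V] {𝒱 : VOSA V}
    {G : Type v} [AddCommGroup G] (Γ : 𝒱.Grading G) : Prop :=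
  ∀ (W : Type u) [AddCommGroup W] [Module ℂ W] (𝓦 : WeakModule 𝒱 W), 𝓦.IsOrdinary →
    ∀ (W₀ : Submodule ℂ W) (hW₀ : (𝓦.restrictAlg Γ.isSubalgebra_zero).IsInvariant W₀),
      ((𝓦.restrictAlg Γ.isSubalgebra_zero).ofInvariant W₀ hW₀).IsIrreducible →
        ∃ (M : Type u) (_ : AddCommGroup M) (_ : Module ℂ M) (𝓜 : WeakModule 𝒱 M)
          (D : 𝓜.GradedBy Γ), 𝓜.IsOrdinary ∧
            D.zeroModule.Isomorphic ((𝓦.restrictAlg Γ.isSubalgebra_zero).ofInvariant W₀ hW₀)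

end

/-! The argument is a Clifford-type descent along the dual group of `G`. Over `V^0` a `V`-module `M`
is a sum of irreducible submodules `N`, so it suffices that each `w ∈ N` generates a semisimple
`V`-submodule: a sum of semisimple submodules is semisimple.

Since `M` need not be `G`-graded, it is replaced by `M ⊗ ℂ[G]`, where `V^g` acts and also shifts the
degree by `g`. Characters of `G` scale the degrees and commute with the modes up to scalars. Let `S`
be generated by `w ⊗ e_0`. A character-stable submodule `P ≠ 0` of `S` is graded by Fourier
inversion (`single_mem_of_char_smul_mem`), so it contains some `u ⊗ e_g` with `u ≠ 0` in `V^g N`. As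
`V` is simple and `V^{-g} ≠ 0`, the vacuum lies in the span of the products `V^g V^{-g}`
(`vac_mem_act_comp`), and associativity gives `u ∈ V^g (V^{-g} u)`. Hence `V^{-g} u` is a nonzero
subspace of `N`, and irreducibility of `N` puts `w ⊗ e_0` in `P` (`single_mem_of_ne_bot`). So `S`
has no proper nonzero character-stable submodule.

The translates of a maximal submodule of the cyclic module `S` then intersect in zero, which embeds
`S` in a finite product of simple modules (`isSemisimpleModule_of_stable_eq_bot_or_top`). Forgetting
the degree maps `S` onto the submodule generated by `w`, which is therefore semisimple. -/

namespace WeakModule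

/-! ### Associativity of modes, as equalities of spans. -/

variable {V : Type u} [AddCommGroup V] [Module ℂ V] {𝒱 : VOSA V}
variable {M : Type u} [AddCommGroup M] [Module ℂ M] (𝓜 : WeakModule 𝒱 M)

/-- Isolates the leading term in one side of the Jacobi identity. The bound `K` makes the support
finite; without it the `finsum` could take its default value `0`. -/
lemma head_mem_of_finsum_mem (S : Submodule ℂ M) {f : ℕ → M} {K : ℕ} (hK : ∀ k, K ≤ k → f k = 0)
    (hsum : ∑ᶠ k, f k ∈ S) (htail : ∀ k, f (k + 1) ∈ S) : f 0 ∈ S := by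
  have hsupp : f.support ⊆ Finset.range (K + 1) := by
    intro k hk
    by_contra hk'
    refine hk (hK k ?_)
    simp at hk'
    omega
  rw [finsum_eq_sum_of_support_subset f hsupp, Finset.sum_range_succ'] at hsum
  exact (S.add_mem_iff_right (S.sum_mem fun k _ => htail k)).1 hsum

/-- Iterated actions `a_m b_n w` are linear combinations of the vectors `(a_r b)_q w`. -/
lemma mode_mode_mem {i j : ZMod 2} {a b : V} (ha : a ∈ 𝒱.part i) (hb : b ∈ 𝒱.part j) (w : M)
    (S : Submodule ℂ M) (hS : ∀ r q, 𝓜.mode q (𝒱.mode r a b) w ∈ S) (m n : ℤ) :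
    𝓜.mode m a (𝓜.mode n b w) ∈ S := by
  obtain ⟨p, hp⟩ := 𝓜.truncation a w
  obtain ⟨N, hN⟩ := 𝓜.truncation b w
  -- Descending induction on `n`, starting where `b_n w = 0`.
  have key : ∀ t : ℕ, ∀ n, N - t ≤ n → ∀ m, 𝓜.mode m a (𝓜.mode n b w) ∈ S := by
    intro t
    induction t with
    | zero =>
      intro n hn m
      rw [hN n (by simpa using hn), map_zero]
      exact S.zero_mem
    | succ t ih =>
      intro n hn m
      -- With this `p` the terms containing `a_{p+k} w` vanish; `r = m - p` makes `a_m b_n w` the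
      -- term `k = 0`, and the other terms involve `b_{n+k} w` with `k > 0`.
      have h := 𝓜.jacobi i j a ha b hb w p n (m - p)
      have hmem : ∑ᶠ k : ℕ, ((-1) ^ k * Ring.choose (m - p) k) •
          𝓜.mode (p + (m - p) - k) a (𝓜.mode (n + k) b w) ∈ S := by
        have : ∀ k : ℕ, 𝓜.mode (p + k) a w = 0 := fun k => hp _ (by omega)
        simp only [this, map_zero, smul_zero, sub_zero] at h
        rw [← h]
        exact finsum_induction (· ∈ S) S.zero_mem (fun _ _ => S.add_mem)
          fun k => zsmul_mem (hS _ _) _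
      have h0 := head_mem_of_finsum_mem S (K := (N - n).toNat) (fun k hk => ?_) hmem fun k => ?_
      · simpa using h0
      · rw [hN (n + k) (by omega), map_zero, smul_zero]
      · exact zsmul_mem (ih _ (by push_cast at hn ⊢; omega) _) _
  exact key (N - n).toNat n (by omega) m

/-- The vectors `(a_r b)_q w` are linear combinations of iterated actions `a_m b_n w`. -/
lemma mode_of_mode_mem {i j : ZMod 2} {a b : V} (ha : a ∈ 𝒱.part i) (hb : b ∈ 𝒱.part j) (w : M)
    (S : Submodule ℂ M) (hS : ∀ m n, 𝓜.mode m a (𝓜.mode n b w) ∈ S) (r q : ℤ) :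
    𝓜.mode q (𝒱.mode r a b) w ∈ S := by
  obtain ⟨p, hp⟩ := 𝓜.truncation a w
  obtain ⟨N, hN⟩ := 𝒱.truncation a b
  have key : ∀ t : ℕ, ∀ r, N - t ≤ r → ∀ q, 𝓜.mode q (𝒱.mode r a b) w ∈ S := by
    intro t
    induction t with
    | zero =>
      intro r hr q
      rw [hN r (by simpa using hr), map_zero, LinearMap.zero_apply]
      exact S.zero_mem
    | succ t ih =>
      intro r hr q
      -- The same choice of `p`, now with the left side isolated: its term `k = 0` is `(a_r b)_q w`,
      -- and the others involve `a_{r+k} b` with `k > 0`.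
      have h := 𝓜.jacobi i j a ha b hb w p (q - p) r
      have hmem : ∑ᶠ k : ℕ, Ring.choose p k •
          𝓜.mode (p + (q - p) - k) (𝒱.mode (r + k) a b) w ∈ S := by
        have : ∀ k : ℕ, 𝓜.mode (p + k) a w = 0 := fun k => hp _ (by omega)
        simp only [this, map_zero, smul_zero, sub_zero] at h
        rw [h]
        exact finsum_induction (· ∈ S) S.zero_mem (fun _ _ => S.add_mem)
          fun k => zsmul_mem (hS _ _) _
      have h0 := head_mem_of_finsum_mem S (K := (N - r).toNat) (fun k hk => ?_) hmem fun k => ?_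
      · simpa using h0
      · rw [hN (r + k) (by omega), map_zero, LinearMap.zero_apply, smul_zero]
      · exact zsmul_mem (ih _ (by push_cast at hr ⊢; omega) _) _
  exact key (N - r).toNat r (by omega) q

/-- The span of all `a_n w` with `a ∈ A`, `w ∈ N`. -/
def act (A : Submodule ℂ V) (N : Submodule ℂ M) : Submodule ℂ M :=
  ⨆ n : ℤ, Submodule.map₂ (𝓜.mode n) A N

lemma mode_mem_act {A : Submodule ℂ V} {N : Submodule ℂ M} (n : ℤ) {a : V} (ha : a ∈ A) {w : M}
    (hw : w ∈ N) : 𝓜.mode n a w ∈ 𝓜.act A N :=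
  Submodule.mem_iSup_of_mem n (Submodule.apply_mem_map₂ _ ha hw)

lemma act_le {A : Submodule ℂ V} {N S : Submodule ℂ M} :
    𝓜.act A N ≤ S ↔ ∀ n, ∀ a ∈ A, ∀ w ∈ N, 𝓜.mode n a w ∈ S := by
  simp only [act, iSup_le_iff, Submodule.map₂_le]

lemma act_mono {A B : Submodule ℂ V} {N P : Submodule ℂ M} (hAB : A ≤ B) (hNP : N ≤ P) :
    𝓜.act A N ≤ 𝓜.act B P :=
  (𝓜.act_le).2 fun n _ ha _ hw => 𝓜.mode_mem_act n (hAB ha) (hNP hw)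

/-- The Jacobi identity is available only for vectors of definite parity. A subspace stable under
`L(0)` is spanned by weight vectors, which have definite parity, so inclusions can be tested on
those. -/
lemma _root_.VOSA.le_of_inf_part_le {A Q : Submodule ℂ V} (hA : ∀ x ∈ A, 𝒱.L 0 x ∈ A)
    (h : ∀ i, ∀ a ∈ A, a ∈ 𝒱.part i → a ∈ Q) : A ≤ Q := by
  intro x hx
  obtain ⟨f, hf, hfA, rfl⟩ := VOSA.exists_homogeneous_sum hA x hx
  exact Q.sum_mem fun p _ =>
    h p (f p) (hfA p) (Submodule.mem_iSup_of_mem (⟨p, rfl⟩ : {q : ℤ // (q : ZMod 2) = p}) (hf p))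

/-- Together with `le_act_act`, this is associativity `A(BN) = (AB)N`. The reduction to definite
parity is made in `b` first, with `a` of definite parity, and then in `a`. -/
lemma act_act_le {A B : Submodule ℂ V} (hA : ∀ x ∈ A, 𝒱.L 0 x ∈ A) (hB : ∀ x ∈ B, 𝒱.L 0 x ∈ B)
    (N : Submodule ℂ M) : 𝓜.act A (𝓜.act B N) ≤ 𝓜.act (𝒱.adjoint.act A B) N := by
  set S := 𝓜.act (𝒱.adjoint.act A B) N
  have key : ∀ m n, ∀ w ∈ N, ∀ a ∈ A, ∀ b ∈ B, 𝓜.mode m a (𝓜.mode n b w) ∈ S := by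
    intro m n w hw a ha b hb
    have h1 : ∀ i, ∀ a ∈ A, a ∈ 𝒱.part i →
        B ≤ S.comap ((𝓜.mode m a).comp ((𝓜.mode n).flip w)) := fun i a ha hai =>
      VOSA.le_of_inf_part_le hB fun j b hb hbj =>
        𝓜.mode_mode_mem hai hbj w S (fun r q =>
          𝓜.mode_mem_act q (𝒱.adjoint.mode_mem_act r ha hb) hw) m n
    have h2 : A ≤ S.comap ((𝓜.mode m).flip (𝓜.mode n b w)) :=
      VOSA.le_of_inf_part_le hA fun i a ha hai => h1 i a ha hai hb
    exact h2 ha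
  refine (𝓜.act_le).2 fun m a ha w hw => ?_
  have : 𝓜.act B N ≤ S.comap (𝓜.mode m a) :=
    (𝓜.act_le).2 fun n b hb w hw => key m n w hw a ha b hb
  exact this hw

lemma le_act_act {A B : Submodule ℂ V} (hA : ∀ x ∈ A, 𝒱.L 0 x ∈ A) (hB : ∀ x ∈ B, 𝒱.L 0 x ∈ B)
    (N : Submodule ℂ M) : 𝓜.act (𝒱.adjoint.act A B) N ≤ 𝓜.act A (𝓜.act B N) := by
  set S := 𝓜.act A (𝓜.act B N)
  have key : ∀ r q, ∀ w ∈ N, ∀ a ∈ A, ∀ b ∈ B, 𝓜.mode q (𝒱.mode r a b) w ∈ S := by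
    intro r q w hw a ha b hb
    have h1 : ∀ i, ∀ a ∈ A, a ∈ 𝒱.part i →
        B ≤ S.comap (((𝓜.mode q).flip w).comp (𝒱.mode r a)) := fun i a ha hai =>
      VOSA.le_of_inf_part_le hB fun j b hb hbj =>
        𝓜.mode_of_mode_mem hai hbj w S (fun m n =>
          𝓜.mode_mem_act m ha (𝓜.mode_mem_act n hb hw)) r q
    have h2 : A ≤ S.comap (((𝓜.mode q).flip w).comp ((𝒱.mode r).flip b)) :=
      VOSA.le_of_inf_part_le hA fun i a ha hai => h1 i a ha hai hb
    exact h2 ha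
  refine (𝓜.act_le).2 fun q c hc w hw => ?_
  have : 𝒱.adjoint.act A B ≤ S.comap ((𝓜.mode q).flip w) :=
    (𝒱.adjoint.act_le).2 fun r a ha b hb => key r q w hw a ha b hb
  exact this hc

lemma le_act_of_vac_mem {A : Submodule ℂ V} (hA : 𝒱.vac ∈ A) (N : Submodule ℂ M) :
    N ≤ 𝓜.act A N := by
  intro w hw
  have := 𝓜.mode_mem_act (-1) hA hw
  rwa [𝓜.vac_mode, if_pos rfl] at this

lemma act_bot (A : Submodule ℂ V) : 𝓜.act A ⊥ = ⊥ := by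
  simp [act]

end WeakModule

/-! ### Consequences of simplicity for the graded pieces. -/

namespace VOSA.Grading

variable {V : Type u} [AddCommGroup V] [Module ℂ V] {𝒱 : VOSA V}
variable {G : Type v} [AddCommGroup G] (Γ : 𝒱.Grading G)
variable {M : Type u} [AddCommGroup M] [Module ℂ M] (𝓜 : WeakModule 𝒱 M)

lemma L_zero_mem_comp (g : G) (x : V) (hx : x ∈ Γ.comp g) : 𝒱.L 0 x ∈ Γ.comp g := by
  have := Γ.mode_mem (0 + 1) 0 g _ Γ.conf_mem x hx
  rwa [zero_add g] at this

lemma act_comp_comp_le (g h : G) : 𝒱.adjoint.act (Γ.comp g) (Γ.comp h) ≤ Γ.comp (g + h) :=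
  (𝒱.adjoint.act_le).2 fun n a ha b hb => Γ.mode_mem n g h a ha b hb

lemma act_act_comp_le (g h : G) (N : Submodule ℂ M) :
    𝓜.act (Γ.comp g) (𝓜.act (Γ.comp h) N) ≤ 𝓜.act (Γ.comp (g + h)) N :=
  (𝓜.act_act_le (Γ.L_zero_mem_comp g) (Γ.L_zero_mem_comp h) N).trans
    (𝓜.act_mono (Γ.act_comp_comp_le g h) le_rfl)

lemma coset_top (g : G) : Γ.coset ⊤ g = ⊤ := by
  rw [eq_top_iff, ← Γ.iSup_comp]
  refine iSup_le fun h => ?_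
  refine le_trans (le_of_eq ?_)
    (le_iSup (fun k : (⊤ : AddSubgroup G) => Γ.comp (k + g)) ⟨h - g, trivial⟩)
  simp

/-- By associativity `V b` is an ideal, and it contains `b = 1_{-1} b ≠ 0`. Simplicity is stated on
the subtype of `Γ.coset ⊤ 0`, which is all of `V`, hence the `comap`. -/
lemma vac_mem_act_span (hsimple : (Γ.sub ⊤).IsSimple) {b : V} (hb : b ≠ 0) :
    𝒱.vac ∈ 𝒱.adjoint.act ⊤ (ℂ ∙ b) := by
  set N := 𝒱.adjoint.act ⊤ (ℂ ∙ b)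
  have hinv : ∀ n a, ∀ w ∈ N, 𝒱.mode n a w ∈ N := by
    intro n a w hw
    refine (𝒱.adjoint.act_act_le (by simp) (by simp) (ℂ ∙ b)).trans
      (𝒱.adjoint.act_mono le_top le_rfl) (𝒱.adjoint.mode_mem_act n (Submodule.mem_top (x := a)) hw)
  have hbN : b ∈ N := 𝒱.adjoint.le_act_of_vac_mem Submodule.mem_top _
    (Submodule.mem_span_singleton_self b)
  have hmem : ∀ x : V, x ∈ Γ.coset ⊤ 0 := fun x => by rw [Γ.coset_top]; trivial
  rcases hsimple.2 (N.comap (Γ.coset ⊤ 0).subtype) (fun n a w hw => hinv n a w hw) with h | h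
  · have : (⟨b, hmem b⟩ : Γ.coset ⊤ 0) ∈ N.comap (Γ.coset ⊤ 0).subtype := hbN
    rw [h] at this
    exact absurd (congrArg Subtype.val this) hb
  · have : (⟨𝒱.vac, hmem _⟩ : Γ.coset ⊤ 0) ∈ N.comap (Γ.coset ⊤ 0).subtype := by
      rw [h]; trivial
    exact this

/-- If `V` is simple and `V^{-g} ≠ 0`, the vacuum is a sum of products from `V^g` and `V^{-g}`. -/
lemma vac_mem_act_comp (hsimple : (Γ.sub ⊤).IsSimple) (g : G) (hg : Nontrivial (Γ.comp (-g))) :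
    𝒱.vac ∈ 𝒱.adjoint.act (Γ.comp g) (Γ.comp (-g)) := by
  obtain ⟨⟨b, hb⟩, hb0⟩ := exists_ne (0 : Γ.comp (-g))
  have hb0 : b ≠ 0 := fun h => hb0 (Subtype.ext h)
  have hvac := Γ.vac_mem_act_span hsimple hb0
  set A := 𝒱.adjoint.act (Γ.comp g) (Γ.comp (-g))
  -- Only `V^g` moves `b` into degree `0`; since the vacuum has degree `0`, the part coming from the
  -- other degrees must vanish.
  have hle : 𝒱.adjoint.act ⊤ (ℂ ∙ b) ≤ A ⊔ ⨆ k, ⨆ (_ : k ≠ 0), Γ.comp k := by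
    refine (𝒱.adjoint.act_le).2 fun n a _ w hw => ?_
    have hw' : w ∈ Γ.comp (-g) := (Submodule.span_singleton_le_iff_mem _ _).2 hb hw
    have : ⨆ h, Γ.comp h ≤
        (A ⊔ ⨆ k, ⨆ (_ : k ≠ 0), Γ.comp k).comap ((𝒱.mode n).flip w) := by
      refine iSup_le fun h a ha => ?_
      by_cases hh : h + -g = 0
      · obtain rfl : h = g := by rwa [← sub_eq_add_neg, sub_eq_zero] at hh
        exact Submodule.mem_sup_left (𝒱.adjoint.mode_mem_act n ha hw')
      · exact Submodule.mem_sup_right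
          (Submodule.mem_iSup_of_mem _ (Submodule.mem_iSup_of_mem hh (Γ.mode_mem n _ _ a ha w hw')))
    exact this (by rw [Γ.iSup_comp]; trivial)
  obtain ⟨y, hy, z, hz, hyz⟩ := Submodule.mem_sup.1 (hle hvac)
  have hy0 : y ∈ Γ.comp 0 := by
    have := Γ.act_comp_comp_le g (-g) hy
    rwa [add_neg_cancel] at this
  have hz0 : z ∈ Γ.comp 0 := by
    rw [← (Γ.comp 0).add_mem_iff_right hy0, hyz]
    exact Γ.vac_mem
  have : z = 0 := by simpa using (Submodule.disjoint_def.1 (Γ.independent 0)) z hz0 hz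
  rw [← hyz, this, add_zero]
  exact hy

/-- Write `w = 1_{-1} w` with the vacuum in the span of `V^g V^{-g}`. In particular `V^{-g}` kills
no nonzero vector. -/
lemma le_act_act_neg (hsimple : (Γ.sub ⊤).IsSimple) (g : G) (hg : Nontrivial (Γ.comp (-g)))
    (N : Submodule ℂ M) : N ≤ 𝓜.act (Γ.comp g) (𝓜.act (Γ.comp (-g)) N) :=
  (𝓜.le_act_of_vac_mem (Γ.vac_mem_act_comp hsimple g hg) N).trans
    (𝓜.le_act_act (Γ.L_zero_mem_comp _) (Γ.L_zero_mem_comp _) N)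

end VOSA.Grading

/-! ### Clifford-type criterion for semisimplicity. -/

/-- A finitely generated module on which a finite group acts semilinearly is semisimple if it has
no proper nonzero stable submodules. -/
theorem isSemisimpleModule_of_stable_eq_bot_or_top {R : Type*} [Ring R] {M : Type*}
    [AddCommGroup M] [Module R M] [Module.Finite R M] {K : Type*} [Group K] [Finite K]
    [DistribMulAction K M]
    (hsemi : ∀ (γ : K) (r : R), ∃ r' : R, ∀ x : M, γ • r • x = r' • γ • x)
    (hstable : ∀ P : Submodule R M, (∀ γ : K, ∀ x ∈ P, γ • x ∈ P) → P = ⊥ ∨ P = ⊤) :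
    IsSemisimpleModule R M := by
  -- Semilinearity makes the preimage of a submodule under `γ` a submodule, so `K` acts on the
  -- submodule lattice and preserves coatoms.
  let pre : K → Submodule R M → Submodule R M := fun γ N =>
    { carrier := {x | γ • x ∈ N}
      add_mem' := fun {x y} hx hy => by
        simp only [Set.mem_ofPred_eq, smul_add] at *; exact N.add_mem hx hy
      zero_mem' := by simp
      smul_mem' := fun r x hx => by
        obtain ⟨r', hr'⟩ := hsemi γ r
        simp only [Set.mem_ofPred_eq, hr']
        exact N.smul_mem r' hx }
  have mem_pre : ∀ γ N x, x ∈ pre γ N ↔ γ • x ∈ N := fun _ _ _ => Iff.rfl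
  let e : K → (Submodule R M ≃o Submodule R M) := fun γ =>
    { toFun := pre γ
      invFun := pre γ⁻¹
      left_inv := fun N => by ext x; simp [mem_pre]
      right_inv := fun N => by ext x; simp [mem_pre]
      map_rel_iff' := fun {A B} => by
        refine ⟨fun h x hx => ?_, fun h x hx => h hx⟩
        have : γ⁻¹ • x ∈ pre γ A := by simpa [mem_pre] using hx
        simpa [mem_pre] using h this }
  rcases eq_top_or_exists_le_coatom (⊥ : Submodule R M) with h | ⟨N, hN, -⟩
  · exact IsSemisimpleModule.of_sSup_simples_eq_top (eq_top_iff.2 (h ▸ bot_le))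
  have hsimple : ∀ γ, IsSimpleModule R (M ⧸ pre γ N) := fun γ =>
    isSimpleModule_iff_isCoatom.2 (((e γ).isCoatom_iff N).2 hN)
  -- The group permutes the translates of `N`, so their intersection is stable; it lies in `N`,
  -- hence is proper.
  have hbot : ⨅ γ, pre γ N = ⊥ := by
    refine (hstable _ fun γ x hx => ?_).resolve_right fun h => hN.1 ?_
    · simp only [Submodule.mem_iInf, mem_pre] at hx ⊢
      intro δ
      rw [← mul_smul]
      exact hx _
    · rw [eq_top_iff, ← h]
      refine (iInf_le _ (1 : K)).trans fun x hx => ?_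
      simpa [mem_pre] using hx
  refine IsSemisimpleModule.of_injective (LinearMap.pi fun γ => (pre γ N).mkQ) ?_
  rw [← LinearMap.ker_eq_bot, LinearMap.ker_pi]
  simpa using hbot

/-! ### Families of operators as modules over a free algebra. -/

namespace FreeAlgebra

variable {X M N : Type*} [AddCommGroup M] [Module ℂ M] [AddCommGroup N] [Module ℂ N]
variable [Module (FreeAlgebra ℂ X) M] [IsScalarTower ℂ (FreeAlgebra ℂ X) M]
variable [Module (FreeAlgebra ℂ X) N] [IsScalarTower ℂ (FreeAlgebra ℂ X) N]

/-- A subspace stable under the generators, as a submodule. -/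
def submoduleOfStable (P : Submodule ℂ M) (hP : ∀ x : X, ∀ m ∈ P, ι ℂ x • m ∈ P) :
    Submodule (FreeAlgebra ℂ X) M where
  carrier := P
  add_mem' := P.add_mem
  zero_mem' := P.zero_mem
  smul_mem' r := by
    induction r using FreeAlgebra.induction with
    | grade0 c => intro m hm; rw [algebraMap_smul]; exact P.smul_mem c hm
    | grade1 x => exact hP x _
    | add r s hr hs => intro m hm; rw [add_smul]; exact P.add_mem (hr hm) (hs hm)
    | mul r s hr hs => intro m hm; rw [mul_smul]; exact hr (hs hm)

/-- A linear map commuting with the generators, as a module homomorphism. -/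
def linearMapOfCommute (f : M →ₗ[ℂ] N) (hf : ∀ (x : X) m, f (ι ℂ x • m) = ι ℂ x • f m) :
    M →ₗ[FreeAlgebra ℂ X] N where
  toFun := f
  map_add' := f.map_add
  map_smul' r := by
    simp only [RingHom.id_apply]
    induction r using FreeAlgebra.induction with
    | grade0 c => intro m; rw [algebraMap_smul, algebraMap_smul, map_smul]
    | grade1 x => exact hf x
    | add r s hr hs => intro m; rw [add_smul, add_smul, map_add, hr, hs]
    | mul r s hr hs => intro m; rw [mul_smul, mul_smul, hr, hs]

end FreeAlgebra

/-- A vector space with a family of operators, as a module over the free algebra. -/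
def OperatorModule {X : Type*} {M : Type*} [AddCommGroup M] [Module ℂ M]
    (_ : X → Module.End ℂ M) : Type _ := M

namespace OperatorModule

variable {X M : Type*} [AddCommGroup M] [Module ℂ M] (φ : X → Module.End ℂ M)

instance : AddCommGroup (OperatorModule φ) := inferInstanceAs (AddCommGroup M)

instance : Module ℂ (OperatorModule φ) := inferInstanceAs (Module ℂ M)

instance : Module (FreeAlgebra ℂ X) (OperatorModule φ) :=
  Module.compHom M (FreeAlgebra.lift ℂ φ).toRingHom

/-- The identity map from a vector space to the corresponding module over the free algebra. -/
def of : M ≃ₗ[ℂ] OperatorModule φ := LinearEquiv.refl ℂ M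

lemma ι_smul_of (x : X) (m : M) : FreeAlgebra.ι ℂ x • of φ m = of φ (φ x m) :=
  congrArg (fun f : Module.End ℂ M => f m) (FreeAlgebra.lift_ι_apply φ x)

instance : IsScalarTower ℂ (FreeAlgebra ℂ X) (OperatorModule φ) where
  smul_assoc c r m :=
    congrArg (fun f : Module.End ℂ M => f m) (map_smul (FreeAlgebra.lift ℂ φ) c r)

end OperatorModule

/-! ### The induced graded module and the action of characters. -/

namespace VOSA.Grading

variable {V : Type u} [AddCommGroup V] [Module ℂ V] {𝒱 : VOSA V}
variable {G : Type v} [AddCommGroup G] (Γ : 𝒱.Grading G)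
variable {M : Type u} [AddCommGroup M] [Module ℂ M] (𝓜 : WeakModule 𝒱 M)

/-- The modes of the homogeneous vectors, acting on a weak module `M`. -/
def operators (x : ℤ × Σ g, Γ.comp g) : Module.End ℂ M := 𝓜.mode x.1 x.2.2

/-- The modes of the homogeneous vectors, acting on `G → M`, graded by the support. -/
def shiftOperators (x : ℤ × Σ g, Γ.comp g) : Module.End ℂ (G → M) :=
  LinearMap.pi fun g => (𝓜.mode x.1 x.2.2).comp (LinearMap.proj (g - x.2.1))

lemma shiftOperators_apply (x : ℤ × Σ g, Γ.comp g) (f : G → M) (g : G) :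
    Γ.shiftOperators 𝓜 x f g = 𝓜.mode x.1 x.2.2 (f (g - x.2.1)) := rfl

lemma shiftOperators_single [DecidableEq G] (n : ℤ) {g h : G} (a : Γ.comp g) (w : M) :
    Γ.shiftOperators 𝓜 (n, ⟨g, a⟩) (Pi.single h w) = Pi.single (g + h) (𝓜.mode n a w) := by
  ext k
  rw [shiftOperators_apply]
  by_cases hk : k = g + h
  · subst hk
    simp
  · have : k - g ≠ h := fun h' => hk (by rw [← h', add_sub_cancel])
    simp [hk, this]

/-- `M ⊗ ℂ[G]` as a `G`-graded module. -/
abbrev Induced := OperatorModule (Γ.shiftOperators 𝓜)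

/-- The identification of functions `G → M` with elements of the induced module. -/
abbrev toInduced : (G → M) ≃ₗ[ℂ] Γ.Induced 𝓜 := OperatorModule.of (Γ.shiftOperators 𝓜)

/-- Characters of `G` act on the induced module by scalars on the homogeneous components. -/
instance : DistribMulAction (AddChar G ℂ) (Γ.Induced 𝓜) where
  smul χ x := Γ.toInduced 𝓜 fun g => χ g • (Γ.toInduced 𝓜).symm x g
  one_smul x := by
    obtain ⟨f, rfl⟩ := (Γ.toInduced 𝓜).surjective x
    change Γ.toInduced 𝓜 _ = _
    simp
  mul_smul χ ξ x := by
    obtain ⟨f, rfl⟩ := (Γ.toInduced 𝓜).surjective x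
    change Γ.toInduced 𝓜 _ = Γ.toInduced 𝓜 _
    congr 1
    funext g
    change (χ * ξ) g • f g = χ g • ξ g • f g
    rw [AddChar.mul_apply, mul_smul]
  smul_zero χ := by
    change Γ.toInduced 𝓜 _ = _
    simp
    rfl
  smul_add χ x y := by
    obtain ⟨f, rfl⟩ := (Γ.toInduced 𝓜).surjective x
    obtain ⟨f', rfl⟩ := (Γ.toInduced 𝓜).surjective y
    change Γ.toInduced 𝓜 _ = Γ.toInduced 𝓜 _ + Γ.toInduced 𝓜 _
    rw [← map_add, ← map_add]
    congr 1
    funext g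
    simp

lemma char_smul_toInduced (χ : AddChar G ℂ) (f : G → M) :
    χ • Γ.toInduced 𝓜 f = Γ.toInduced 𝓜 fun g => χ g • f g := rfl

/-- A generator of degree `h` commutes with `χ` up to the scalar `χ h`; sums and products inherit a
twisted partner `r'`. -/
lemma char_smul_smul (χ : AddChar G ℂ) (r : FreeAlgebra ℂ (ℤ × Σ g, Γ.comp g)) :
    ∃ r' : FreeAlgebra ℂ (ℤ × Σ g, Γ.comp g), ∀ x : Γ.Induced 𝓜, χ • r • x = r' • χ • x := by
  induction r using FreeAlgebra.induction with
  | grade0 c =>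
    refine ⟨algebraMap ℂ _ c, fun x => ?_⟩
    obtain ⟨f, rfl⟩ := (Γ.toInduced 𝓜).surjective x
    rw [algebraMap_smul, algebraMap_smul, ← map_smul, char_smul_toInduced, char_smul_toInduced,
      ← map_smul]
    congr 1
    funext g
    exact smul_comm _ _ _
  | grade1 x =>
    refine ⟨χ x.2.1 • FreeAlgebra.ι ℂ x, fun y => ?_⟩
    obtain ⟨f, rfl⟩ := (Γ.toInduced 𝓜).surjective y
    rw [smul_assoc, OperatorModule.ι_smul_of, char_smul_toInduced, char_smul_toInduced,
      OperatorModule.ι_smul_of, ← map_smul]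
    congr 1
    funext g
    rw [Pi.smul_apply, shiftOperators_apply, shiftOperators_apply, map_smul, smul_smul,
      ← AddChar.map_add_eq_mul, add_sub_cancel]
  | add r s hr hs =>
    obtain ⟨r', hr⟩ := hr
    obtain ⟨s', hs⟩ := hs
    exact ⟨r' + s', fun x => by rw [add_smul, smul_add, hr, hs, add_smul]⟩
  | mul r s hr hs =>
    obtain ⟨r', hr⟩ := hr
    obtain ⟨s', hs⟩ := hs
    exact ⟨r' * s', fun x => by rw [mul_smul, hr, hs, mul_smul]⟩

/-- A submodule of the induced module stable under all characters is graded. -/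
lemma single_mem_of_char_smul_mem [Finite G] [DecidableEq G]
    (P : Submodule (FreeAlgebra ℂ (ℤ × Σ g, Γ.comp g)) (Γ.Induced 𝓜))
    (hP : ∀ χ : AddChar G ℂ, ∀ x ∈ P, χ • x ∈ P) {f : G → M} (hf : Γ.toInduced 𝓜 f ∈ P) (g : G) :
    Γ.toInduced 𝓜 (Pi.single g (f g)) ∈ P := by
  cases nonempty_fintype G
  -- The averaged sum of `χ (-g) • χ` is the projection onto degree `g`, by orthogonality of
  -- characters.
  have hsum : (Fintype.card G : ℂ)⁻¹ • ∑ χ : AddChar G ℂ, χ (-g) • χ • Γ.toInduced 𝓜 f ∈ P :=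
    P.smul_of_tower_mem _ (P.sum_mem fun χ _ => P.smul_of_tower_mem _ (hP χ _ hf))
  convert hsum using 1
  simp only [char_smul_toInduced, ← map_smul, ← map_sum]
  congr 1
  funext h
  have : ∀ χ : AddChar G ℂ, χ (-g) • χ h • f h = χ (h - g) • f h := fun χ => by
    rw [smul_smul, ← AddChar.map_add_eq_mul, neg_add_eq_sub]
  simp only [Pi.smul_apply, Finset.sum_apply, this, ← Finset.sum_smul, AddChar.sum_apply_eq_ite,
    sub_eq_zero]
  by_cases hh : h = g
  · subst hh
    simp [smul_smul]
  · simp [hh]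

variable {Γ} in
/-- The induced module of an irreducible `V^0`-submodule has no nontrivial graded submodules. -/
lemma single_mem_of_ne_bot [Finite G] [DecidableEq G] (hsimple : (Γ.sub ⊤).IsSimple)
    (hne : ∀ g, Nontrivial (Γ.comp g)) {N : Submodule ℂ M} (hN : 𝓜.act (Γ.comp 0) N ≤ N)
    (hmin : ∀ X ≤ N, 𝓜.act (Γ.comp 0) X ≤ X → X = ⊥ ∨ X = N) {w : M} (hw : w ∈ N)
    (P : Submodule (FreeAlgebra ℂ (ℤ × Σ g, Γ.comp g)) (Γ.Induced 𝓜))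
    (hPw : P ≤ Submodule.span _ {Γ.toInduced 𝓜 (Pi.single 0 w)})
    (hP : ∀ χ : AddChar G ℂ, ∀ x ∈ P, χ • x ∈ P) (hbot : P ≠ ⊥) :
    Γ.toInduced 𝓜 (Pi.single 0 w) ∈ P := by
  -- The graded subspace with component `V^g N` in degree `g`; it contains everything generated by
  -- `w ⊗ e_0`.
  let Q : Submodule ℂ (Γ.Induced 𝓜) :=
    (Submodule.pi Set.univ fun g => 𝓜.act (Γ.comp g) N).map (Γ.toInduced 𝓜).toLinearMap
  have hQ : ∀ x : ℤ × Σ g, Γ.comp g, ∀ m ∈ Q, FreeAlgebra.ι ℂ x • m ∈ Q := by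
    rintro ⟨n, h, a⟩ _ ⟨f, hf, rfl⟩
    refine ⟨_, fun g _ => ?_, (OperatorModule.ι_smul_of _ _ _).symm⟩
    have := Γ.act_act_comp_le 𝓜 h (g - h) N (𝓜.mode_mem_act n a.2 (hf (g - h) trivial))
    rwa [add_sub_cancel] at this
  have hspan : Submodule.span _ {Γ.toInduced 𝓜 (Pi.single 0 w)} ≤
      FreeAlgebra.submoduleOfStable Q hQ := by
    refine (Submodule.span_singleton_le_iff_mem _ _).2 ⟨_, fun g _ => ?_, rfl⟩
    by_cases hg : g = 0
    · subst hg
      rw [Pi.single_eq_same]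
      exact 𝓜.le_act_of_vac_mem Γ.vac_mem N hw
    · rw [Pi.single_eq_of_ne hg]
      exact Submodule.zero_mem _
  obtain ⟨x, hxP, hx0⟩ := (Submodule.ne_bot_iff P).1 hbot
  obtain ⟨f, hf, hfx⟩ : ∃ f : G → M, (∀ g, f g ∈ 𝓜.act (Γ.comp g) N) ∧ Γ.toInduced 𝓜 f = x := by
    obtain ⟨f, hf, rfl⟩ := hspan (hPw hxP)
    exact ⟨f, fun g => hf g trivial, rfl⟩
  subst hfx
  obtain ⟨g, hg⟩ : ∃ g, f g ≠ 0 := by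
    by_contra! h
    exact hx0 (by rw [show f = 0 from funext h, map_zero])
  have hgP := Γ.single_mem_of_char_smul_mem 𝓜 P hP hxP g
  -- The vectors `u ∈ N` with `u ⊗ e_0 ∈ P`; they form a `V^0`-submodule, so `X` is `0` or `N`.
  let X : Submodule ℂ M := N ⊓ ((P.restrictScalars ℂ).comap
    ((Γ.toInduced 𝓜).toLinearMap.comp (LinearMap.single ℂ (fun _ : G => M) 0)))
  have hmode : ∀ {k h l : G} (n : ℤ) (a : V) (_ : a ∈ Γ.comp k) (u : M), k + h = l →
      Γ.toInduced 𝓜 (Pi.single h u) ∈ P → Γ.toInduced 𝓜 (Pi.single l (𝓜.mode n a u)) ∈ P := by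
    rintro k h _ n a ha u rfl hu
    have := P.smul_mem (FreeAlgebra.ι ℂ (n, (⟨k, a, ha⟩ : Σ g, Γ.comp g))) hu
    rwa [OperatorModule.ι_smul_of, shiftOperators_single] at this
  have hXinv : 𝓜.act (Γ.comp 0) X ≤ X := by
    refine (𝓜.act_le).2 fun n a ha u hu => ⟨hN (𝓜.mode_mem_act n ha hu.1), ?_⟩
    exact hmode n a ha u (zero_add 0) hu.2
  rcases hmin X inf_le_left hXinv with hX | hX
  -- Here `V^{-g} (f g)` lies in `X = 0`, so `f g ∈ V^g (V^{-g} (f g)) = 0`.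
  · exfalso
    have hsub : 𝓜.act (Γ.comp (-g)) (ℂ ∙ f g) ≤ X := by
      refine (𝓜.act_le).2 fun n a ha u hu => ?_
      obtain ⟨c, rfl⟩ := Submodule.mem_span_singleton.1 hu
      rw [map_smul]
      refine X.smul_mem c ⟨?_, hmode n a ha _ (neg_add_cancel g) hgP⟩
      have := Γ.act_act_comp_le 𝓜 (-g) g N (𝓜.mode_mem_act n ha (hf g))
      rw [neg_add_cancel] at this
      exact hN this
    have := Γ.le_act_act_neg 𝓜 hsimple g (hne _) _ (Submodule.mem_span_singleton_self (f g))
    rw [eq_bot_iff.2 (hsub.trans hX.le), 𝓜.act_bot] at this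
    exact hg this
  · rw [← hX] at hw
    exact hw.2

variable {Γ} in
/-- The submodule generated by a vector of an irreducible `V^0`-submodule is semisimple. -/
theorem isSemisimpleModule_span [Finite G] (hsimple : (Γ.sub ⊤).IsSimple)
    (hne : ∀ g, Nontrivial (Γ.comp g)) {N : Submodule ℂ M} (hN : 𝓜.act (Γ.comp 0) N ≤ N)
    (hmin : ∀ X ≤ N, 𝓜.act (Γ.comp 0) X ≤ X → X = ⊥ ∨ X = N) {w : M} (hw : w ∈ N) :
    IsSemisimpleModule (FreeAlgebra ℂ (ℤ × Σ g, Γ.comp g))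
      (Submodule.span (FreeAlgebra ℂ (ℤ × Σ g, Γ.comp g))
        {OperatorModule.of (Γ.operators 𝓜) w}) := by
  classical
  cases nonempty_fintype G
  set m₀ := Γ.toInduced 𝓜 (Pi.single 0 w) with hm₀
  set S := Submodule.span (FreeAlgebra ℂ (ℤ × Σ g, Γ.comp g)) {m₀} with hS
  have hmS : m₀ ∈ S := Submodule.mem_span_singleton_self m₀
  -- The generator sits in degree `0`, where every character is `1`; so the cyclic module `S` is
  -- stable under characters.
  have hchar : ∀ χ : AddChar G ℂ, χ • m₀ = m₀ := by
    intro χ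
    rw [hm₀, char_smul_toInduced]
    congr 1
    funext g
    by_cases hg : g = 0
    · subst hg
      simp
    · simp [hg]
  have hstab : ∀ (χ : AddChar G ℂ), ∀ x ∈ S, χ • x ∈ S := by
    intro χ x hx
    obtain ⟨r, rfl⟩ := Submodule.mem_span_singleton.1 hx
    obtain ⟨r', hr'⟩ := Γ.char_smul_smul 𝓜 χ r
    rw [hr', hchar]
    exact S.smul_mem r' hmS
  let _ : DistribMulAction (AddChar G ℂ) S :=
    { smul := fun χ x => ⟨χ • (x : Γ.Induced 𝓜), hstab χ x x.2⟩
      one_smul := fun x => Subtype.ext (one_smul _ (x : Γ.Induced 𝓜))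
      mul_smul := fun χ ξ x => Subtype.ext (mul_smul χ ξ (x : Γ.Induced 𝓜))
      smul_zero := fun χ => Subtype.ext (smul_zero χ)
      smul_add := fun χ x y => Subtype.ext (smul_add χ (x : Γ.Induced 𝓜) y) }
  have hss : IsSemisimpleModule (FreeAlgebra ℂ (ℤ × Σ g, Γ.comp g)) S := by
    refine isSemisimpleModule_of_stable_eq_bot_or_top (K := AddChar G ℂ) (fun χ r => ?_)
      fun P hP => ?_
    · obtain ⟨r', hr'⟩ := Γ.char_smul_smul 𝓜 χ r
      exact ⟨r', fun x => Subtype.ext (hr' x)⟩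
    · rw [or_iff_not_imp_left]
      intro hbot
      have := single_mem_of_ne_bot 𝓜 hsimple hne hN hmin hw (P.map S.subtype)
        (Submodule.map_subtype_le _ _) (by
          rintro χ _ ⟨x, hx, rfl⟩
          exact ⟨χ • x, hP χ x hx, rfl⟩)
        (fun h => hbot (Submodule.map_injective_of_injective S.injective_subtype
          (h.trans (Submodule.map_bot _).symm)))
      obtain ⟨y, hy, hyw⟩ := this
      rw [eq_top_iff]
      rintro ⟨x, hx⟩ -
      obtain ⟨r, rfl⟩ := Submodule.mem_span_singleton.1 hx
      have : (⟨r • m₀, hx⟩ : S) = r • y := 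
        Subtype.ext (congrArg (r • ·) (hm₀.trans hyw.symm))
      rw [this]
      exact P.smul_mem r hy
  -- Summing the components forgets the degree; a shift of degree only permutes the summands, so the
  -- sum commutes with the modes.
  let σ : Γ.Induced 𝓜 →ₗ[FreeAlgebra ℂ (ℤ × Σ g, Γ.comp g)] OperatorModule (Γ.operators 𝓜) :=
    FreeAlgebra.linearMapOfCommute
      ((OperatorModule.of (Γ.operators 𝓜)).toLinearMap ∘ₗ
        (∑ g, LinearMap.proj g) ∘ₗ (Γ.toInduced 𝓜).symm.toLinearMap) (by
      rintro x m
      obtain ⟨f, rfl⟩ := (Γ.toInduced 𝓜).surjective m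
      simp only [OperatorModule.ι_smul_of, LinearMap.comp_apply, LinearEquiv.coe_coe,
        LinearEquiv.symm_apply_apply, LinearMap.sum_apply, LinearMap.proj_apply,
        shiftOperators_apply]
      congr 1
      rw [← map_sum]
      exact congrArg _ (Equiv.sum_comp (Equiv.subRight x.2.1) f))
  have hσ : σ m₀ = OperatorModule.of (Γ.operators 𝓜) w := by
    change OperatorModule.of (Γ.operators 𝓜)
      ((∑ g, LinearMap.proj g : (G → M) →ₗ[ℂ] M) (Pi.single 0 w)) = _
    simp [LinearMap.sum_apply]
  rw [← hσ, ← Set.image_singleton, ← Submodule.map_span, ← hS]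
  exact IsSemisimpleModule.of_surjective (σ.submoduleMap S) (σ.submoduleMap_surjective S)

end VOSA.Grading

/-! ### Transfer between weak modules and modules over the free algebra. -/

namespace VOSA.Grading

variable {V : Type u} [AddCommGroup V] [Module ℂ V] {𝒱 : VOSA V}
variable {G : Type v} [AddCommGroup G] (Γ : 𝒱.Grading G)
variable {M : Type u} [AddCommGroup M] [Module ℂ M] (𝓜 : WeakModule 𝒱 M)

/-- The subspace underlying a submodule over the free algebra on the homogeneous modes. -/
def underlying (N : Submodule (FreeAlgebra ℂ (ℤ × Σ g, Γ.comp g))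
    (OperatorModule (Γ.operators 𝓜))) : Submodule ℂ M :=
  (N.restrictScalars ℂ).comap (OperatorModule.of (Γ.operators 𝓜)).toLinearMap

/-- The generators are modes of homogeneous vectors only, but the `V^g` span `V`. -/
lemma isInvariant_underlying (N : Submodule (FreeAlgebra ℂ (ℤ × Σ g, Γ.comp g))
    (OperatorModule (Γ.operators 𝓜))) : 𝓜.IsInvariant (Γ.underlying 𝓜 N) := by
  intro n a w hw
  have : ⨆ g, Γ.comp g ≤ (Γ.underlying 𝓜 N).comap ((𝓜.mode n).flip w) := by
    refine iSup_le fun g a ha => ?_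
    have : OperatorModule.of (Γ.operators 𝓜) w ∈ N := hw
    have := N.smul_mem (FreeAlgebra.ι ℂ (n, (⟨g, a, ha⟩ : Σ g, Γ.comp g))) this
    rwa [OperatorModule.ι_smul_of] at this
  exact this (by rw [Γ.iSup_comp]; trivial)

variable {𝓜} in
/-- A submodule of a weak module, as a submodule over the free algebra on the homogeneous modes. -/
def ofInvariant {N : Submodule ℂ M} (hN : 𝓜.IsInvariant N) :
    Submodule (FreeAlgebra ℂ (ℤ × Σ g, Γ.comp g)) (OperatorModule (Γ.operators 𝓜)) :=
  FreeAlgebra.submoduleOfStable (N.map (OperatorModule.of (Γ.operators 𝓜)).toLinearMap) (by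
    rintro ⟨n, g, a⟩ _ ⟨w, hw, rfl⟩
    exact ⟨_, hN n a w hw, (OperatorModule.ι_smul_of (Γ.operators 𝓜) (n, ⟨g, a⟩) w).symm⟩)

variable {𝓜} in
lemma underlying_ofInvariant {N : Submodule ℂ M} (hN : 𝓜.IsInvariant N) :
    Γ.underlying 𝓜 (Γ.ofInvariant hN) = N := by
  ext w
  refine ⟨?_, fun h => ⟨w, h, rfl⟩⟩
  rintro ⟨w', hw', h⟩
  rwa [← (OperatorModule.of (Γ.operators 𝓜)).injective h]

lemma underlying_injective : Function.Injective (Γ.underlying 𝓜) := by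
  intro N N' h
  ext x
  obtain ⟨w, rfl⟩ := (OperatorModule.of (Γ.operators 𝓜)).surjective x
  exact SetLike.ext_iff.1 h w

lemma underlying_bot : Γ.underlying 𝓜 ⊥ = ⊥ := by
  ext w
  exact LinearEquiv.map_eq_zero_iff _

lemma underlying_le_iff {N N' : Submodule (FreeAlgebra ℂ (ℤ × Σ g, Γ.comp g))
    (OperatorModule (Γ.operators 𝓜))} :
    Γ.underlying 𝓜 N ≤ Γ.underlying 𝓜 N' ↔ N ≤ N' := by
  refine ⟨fun h x hx => ?_, fun h w hw => h hw⟩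
  obtain ⟨w, rfl⟩ := (OperatorModule.of (Γ.operators 𝓜)).surjective x
  exact h hx

lemma isInvariant_sSup {T : Set (Submodule ℂ M)} (hT : ∀ N ∈ T, 𝓜.IsInvariant N) :
    𝓜.IsInvariant (sSup T) := by
  intro n a
  have : sSup T ≤ (sSup T).comap (𝓜.mode n a) :=
    sSup_le fun N hN w hw => (le_sSup hN : N ≤ sSup T) (hT N hN n a w hw)
  exact fun w hw => this hw

lemma underlying_sSup (T : Set (Submodule (FreeAlgebra ℂ (ℤ × Σ g, Γ.comp g))
    (OperatorModule (Γ.operators 𝓜)))) :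
    Γ.underlying 𝓜 (sSup T) = sSup (Γ.underlying 𝓜 '' T) := by
  refine le_antisymm ?_ (sSup_le ?_)
  · have hinv : 𝓜.IsInvariant (sSup (Γ.underlying 𝓜 '' T)) :=
      isInvariant_sSup 𝓜 (by rintro _ ⟨N, -, rfl⟩; exact Γ.isInvariant_underlying 𝓜 N)
    rw [← Γ.underlying_ofInvariant hinv, underlying_le_iff]
    refine sSup_le fun N hN => ?_
    rw [← Γ.underlying_le_iff, underlying_ofInvariant]
    exact le_sSup ⟨N, hN, rfl⟩
  · rintro _ ⟨N, hN, rfl⟩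
    exact (Γ.underlying_le_iff 𝓜).2 (le_sSup hN)

lemma isIrreducible_underlying (N : Submodule (FreeAlgebra ℂ (ℤ × Σ g, Γ.comp g))
    (OperatorModule (Γ.operators 𝓜)))
    (hN : IsSimpleModule (FreeAlgebra ℂ (ℤ × Σ g, Γ.comp g)) N) :
    (𝓜.ofInvariant (Γ.underlying 𝓜 N) (Γ.isInvariant_underlying 𝓜 N)).IsIrreducible := by
  have hatom := isSimpleModule_iff_isAtom.1 hN
  refine ⟨?_, fun K hK => ?_⟩
  · rw [Submodule.nontrivial_iff_ne_bot, ← Γ.underlying_bot]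
    exact fun h => hatom.1 (Γ.underlying_injective 𝓜 h)
  · have hK' : 𝓜.IsInvariant (K.map (Γ.underlying 𝓜 N).subtype) := by
      rintro n a _ ⟨w, hw, rfl⟩
      exact ⟨_, hK n a w hw, rfl⟩
    have hle : Γ.ofInvariant hK' ≤ N := by
      rw [← Γ.underlying_le_iff, underlying_ofInvariant]
      exact Submodule.map_subtype_le _ _
    have hinj := Submodule.map_injective_of_injective (Γ.underlying 𝓜 N).injective_subtype
    have hKe := Γ.underlying_ofInvariant hK'
    rcases hatom.le_iff.1 hle with h | h
    · left
      rw [h, underlying_bot] at hKe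
      exact hinj (hKe.symm.trans (Submodule.map_bot _).symm)
    · right
      rw [h] at hKe
      exact hinj (hKe.symm.trans (Submodule.map_subtype_top _).symm)

lemma isCompletelyReducible_of_isSemisimpleModule
    [IsSemisimpleModule (FreeAlgebra ℂ (ℤ × Σ g, Γ.comp g)) (OperatorModule (Γ.operators 𝓜))] :
    𝓜.IsCompletelyReducible := by
  obtain ⟨T, hind, htop, hsimple⟩ := IsSemisimpleModule.exists_sSupIndep_sSup_simples_eq_top
    (FreeAlgebra ℂ (ℤ × Σ g, Γ.comp g)) (OperatorModule (Γ.operators 𝓜))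
  refine ⟨Γ.underlying 𝓜 '' T, ?_, ?_, ?_⟩
  · rintro _ ⟨N, hN, rfl⟩
    exact ⟨_, Γ.isIrreducible_underlying 𝓜 N (hsimple N hN)⟩
  · rintro _ ⟨N, hN, rfl⟩
    rw [← Set.image_singleton, ← Set.image_sdiff (Γ.underlying_injective 𝓜), ← underlying_sSup,
      disjoint_iff, ← Γ.underlying_bot, ← disjoint_iff.1 (hind hN)]
    rfl
  · rw [← underlying_sSup, htop]
    rfl

variable {Γ 𝓜} in
/-- If `V` is simple and all `V^g` are nonzero, then a weak `V`-module that is completely reducible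
over `V^0` is completely reducible. -/
theorem isCompletelyReducible_of_restrictAlg [Finite G] (hsimple : (Γ.sub ⊤).IsSimple)
    (hne : ∀ g, Nontrivial (Γ.comp g))
    (h : (𝓜.restrictAlg Γ.isSubalgebra_zero).IsCompletelyReducible) :
    𝓜.IsCompletelyReducible := by
  -- Only the fact that the irreducibles span `M` matters; independent `V`-summands come afterwards
  -- from semisimplicity.
  obtain ⟨T, hT, -, htop⟩ := h
  have hspan : ∀ w : {w : M // ∃ N ∈ T, w ∈ N},
      IsSemisimpleModule (FreeAlgebra ℂ (ℤ × Σ g, Γ.comp g))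
        (Submodule.span (FreeAlgebra ℂ (ℤ × Σ g, Γ.comp g))
          {OperatorModule.of (Γ.operators 𝓜) w.1}) := by
    rintro ⟨w, N, hN, hw⟩
    obtain ⟨hinv, hirr⟩ := hT N hN
    refine isSemisimpleModule_span 𝓜 hsimple hne
      ((𝓜.act_le).2 fun n a ha w hw => hinv n ⟨a, ha⟩ w hw) (fun X hX hXinv => ?_) hw
    have hmap : (X.comap N.subtype).map N.subtype = X := by
      rw [Submodule.map_comap_subtype, inf_eq_right.2 hX]
    rcases hirr.2 (X.comap N.subtype)
      fun n a w hw => hXinv (𝓜.mode_mem_act n a.2 hw) with h | h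
    · left
      rw [← hmap, h, Submodule.map_bot]
    · right
      rw [← hmap, h, Submodule.map_subtype_top]
  have : IsSemisimpleModule (FreeAlgebra ℂ (ℤ × Σ g, Γ.comp g))
      (OperatorModule (Γ.operators 𝓜)) := by
    refine isSemisimpleModule_of_isSemisimpleModule_submodule' hspan (eq_top_iff.2 fun x _ => ?_)
    obtain ⟨w, rfl⟩ := (OperatorModule.of (Γ.operators 𝓜)).surjective x
    have hle : sSup T ≤ Γ.underlying 𝓜 (⨆ w : {w : M // ∃ N ∈ T, w ∈ N}, Submodule.span _
        {OperatorModule.of (Γ.operators 𝓜) w.1}) := sSup_le fun N hN w hw =>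
      (le_iSup (fun w : {w : M // ∃ N ∈ T, w ∈ N} => Submodule.span
          (FreeAlgebra ℂ (ℤ × Σ g, Γ.comp g)) {OperatorModule.of (Γ.operators 𝓜) w.1})
        ⟨w, N, hN, hw⟩) (Submodule.mem_span_singleton_self (OperatorModule.of (Γ.operators 𝓜) w))
    exact hle (by rw [htop]; trivial)
  exact Γ.isCompletelyReducible_of_isSemisimpleModule 𝓜

end VOSA.Grading

theorem theorem4p4 {V : Type u} [AddCommGroup V] [Module ℂ V] (𝒱 : VOSA V)
    {G : Type v} [AddCommGroup G] [Finite G] (Γ : 𝒱.Grading G)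
    (hsimple : Γ.zero.IsSimple) (hrational : Γ.zero.IsRational)
    (hcurrent : ∀ g : G, (Γ.compModule g).IsSimpleCurrent (𝒱.parityOn (Γ.comp g)))
    (hsub : ∀ H : AddSubgroup G, (Γ.sub H).IsSimple)
    (hsubcurrent : ∀ (H : AddSubgroup G) (g : G),
      (Γ.cosetModule H g).IsSimpleCurrent (𝒱.parityOn (Γ.coset H g)))
    (hlift : Γ.LiftingProperty) :
    𝒱.IsRational := by
  intro M _ _ 𝓜 hM
  -- Each `V^g` is nonzero because it is irreducible over `V^0`. The conformal vector lies in `V^0`,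
  -- so `L(0)` and its eigenspaces on `M` are unchanged by restriction.
  exact VOSA.Grading.isCompletelyReducible_of_restrictAlg (hsub ⊤) (fun g => (hcurrent g).1.1)
    (hrational M (𝓜.restrictAlg Γ.isSubalgebra_zero) ⟨hM.1, hM.2, hM.3⟩)
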